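/- For $h\in C([0,1])$ let $$F(h)(x)=\sum_{k\ge 1}2^{-k}\left(h\left(\frac{x}{x+2^k}\right)-h\left(\frac{1}{1+2^kx}\right)\right),\qquad x\in[0,1];$$ $F$ (Brent's operator) is a bounded linear operator on $C([0,1])$ with the supremum norm. For $h\in L^1([0,1])$ let $$B_2(h)(x)=\sum_{k\ge 1}\left(\left(\frac{1}{x+2^k}\right)^2h\left(\frac{x}{x+2^k}\right)+\left(\frac{1}{1+2^kx}\right)^2h\left(\frac{1}{1+2^kx}\right)\right);$$ the series converges absolutely for almost every $x\in[0,1]$, and $B_2$ (the binary Euclidean operator) is a bounded linear operator on $L^1([0,1])$. Define $g_n\in C([0,1])$ by $g_0(x)=1-x$ and $g_{n+1}=F(g_n)$ for $n\ge 0$. **Theorem.** The sequence $(g_n)_{n\ge 0}$ possesses a unique accumulation point $g_\infty$ (i.e. a unique limit of subsequences) in the Banach space $(C([0,1]),\|\cdot\|_\infty)$. The whole sequence converges uniformly on $[0,1]$ to $g_\infty$, and $F(g_\infty)=g_\infty$. Moreover, each $g_n$ is differentiable on $(0,1)$, $g_\infty$ is differentiable almost everywhere on $[0,1]$, the derivatives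 $g_n'$ and $g_\infty'$ are integrable on $[0,1]$, the sequence $(g_n')_{n\ge 0}$ converges to $g_\infty'$ almost everywhere on $[0,1]$ and in the norm of $L^1([0,1])$, and $B_2(g_\infty')=g_\infty'$ in $L^1([0,1])$. -/

import Mathlib

open MeasureTheory Set Filter Topology
open scoped unitInterval ENNReal

noncomputable section

namespace BinaryGcd

/-- The map `x ↦ x / (x + 2 ^ k)`. -/
def lowBranch (k : ℕ) (x : ℝ) : ℝ := x / (x + 2 ^ k)

/-- The map `x ↦ 1 / (1 + 2 ^ k * x)`. -/
def highBranch (k : ℕ) (x : ℝ) : ℝ := 1 / (1 + 2 ^ k * x)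

theorem lowBranch_mem (k : ℕ) {x : ℝ} (hx : x ∈ I) : lowBranch k x ∈ I := by
  have h2 : (0 : ℝ) < 2 ^ k := by positivity
  have h0 : 0 ≤ x := hx.1
  exact ⟨by unfold lowBranch; positivity,
    by unfold lowBranch; rw [div_le_one (by positivity)]; linarith⟩

theorem highBranch_mem (k : ℕ) {x : ℝ} (hx : x ∈ I) : highBranch k x ∈ I := by
  have h0 : 0 ≤ x := hx.1
  have h1 : 0 ≤ 2 ^ k * x := by positivity
  exact ⟨by unfold highBranch; positivity,
    by unfold highBranch; rw [div_le_one (by positivity)]; linarith⟩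

/-- `lowBranch k` as a continuous self-map of `[0, 1]`. -/
def lowMap (k : ℕ) : C(I, I) where
  toFun x := ⟨lowBranch k x, lowBranch_mem k x.2⟩
  continuous_toFun := by
    refine Continuous.subtype_mk ?_ _
    unfold lowBranch
    refine continuous_subtype_val.div (by fun_prop) fun x => ?_
    have h0 : 0 ≤ (x : ℝ) := x.2.1
    positivity

/-- `highBranch k` as a continuous self-map of `[0, 1]`. -/
def highMap (k : ℕ) : C(I, I) where
  toFun x := ⟨highBranch k x, highBranch_mem k x.2⟩
  continuous_toFun := by
    refine Continuous.subtype_mk ?_ _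
    unfold highBranch
    refine continuous_const.div (by fun_prop) fun x => ?_
    have h0 : 0 ≤ (x : ℝ) := x.2.1
    positivity

theorem brent_term_bound (h : C(I, ℝ)) (x : I) (k : ℕ) :
    ‖(1 / 2 : ℝ) ^ (k + 1) * (h (lowMap (k + 1) x) - h (highMap (k + 1) x))‖
      ≤ (1 / 2 : ℝ) ^ k * ‖h‖ := by
  have h1 := h.norm_coe_le_norm (lowMap (k + 1) x)
  have h2 := h.norm_coe_le_norm (highMap (k + 1) x)
  have h3 := norm_sub_le (h (lowMap (k + 1) x)) (h (highMap (k + 1) x))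
  rw [norm_mul, norm_pow, show ‖(1 / 2 : ℝ)‖ = 1 / 2 by norm_num, pow_succ, mul_assoc]
  gcongr
  linarith

theorem brent_bound_summable (h : C(I, ℝ)) : Summable fun k : ℕ => (1 / 2 : ℝ) ^ k * ‖h‖ :=
  (summable_geometric_two).mul_right _

theorem brent_summable (h : C(I, ℝ)) (x : I) :
    Summable fun k : ℕ =>
      (1 / 2 : ℝ) ^ (k + 1) * (h (lowMap (k + 1) x) - h (highMap (k + 1) x)) :=
  Summable.of_norm_bounded (brent_bound_summable h) (brent_term_bound h x)

/-- The function `F(h)` on `[0, 1]` (the series over `k ≥ 1` is indexed by `k + 1`, `k : ℕ`). -/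
def brentFun (h : C(I, ℝ)) : C(I, ℝ) where
  toFun x := ∑' k : ℕ,
    (1 / 2 : ℝ) ^ (k + 1) * (h (lowMap (k + 1) x) - h (highMap (k + 1) x))
  continuous_toFun :=
    continuous_tsum (fun k => by fun_prop) (brent_bound_summable h)
      (fun k x => brent_term_bound h x k)

/-- Brent's operator `F`, a bounded linear operator of `C([0, 1])` with the supremum norm. -/
def brentOp : C(I, ℝ) →L[ℝ] C(I, ℝ) :=
  LinearMap.mkContinuous
    { toFun := brentFun
      map_add' := fun f g => by
        ext x
        simp only [brentFun, ContinuousMap.coe_mk, ContinuousMap.add_apply]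
        rw [← (brent_summable f x).tsum_add (brent_summable g x)]
        exact tsum_congr fun k => by ring
      map_smul' := fun c f => by
        ext x
        simp only [brentFun, ContinuousMap.coe_mk, ContinuousMap.smul_apply, smul_eq_mul,
          RingHom.id_apply]
        rw [← tsum_mul_left]
        exact tsum_congr fun k => by ring }
    2 fun h => by
      rw [ContinuousMap.norm_le _ (by positivity)]
      intro x
      refine tsum_of_norm_bounded ?_ (brent_term_bound h x)
      exact hasSum_geometric_two.mul_right ‖h‖

/-- The sequence `g₀(x) = 1 - x`, `gₙ₊₁ = F(gₙ)`. -/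
def brentSeq : ℕ → C(I, ℝ)
  | 0 => ⟨fun x => 1 - (x : ℝ), by fun_prop⟩
  | n + 1 => brentOp (brentSeq n)

/-- The derivative of a function on `[0, 1]`. The function is first extended to `ℝ` by constants:
this does not affect the derivative at the points of `(0, 1)`. -/
def derivUnit (h : C(I, ℝ)) : ℝ → ℝ := deriv (IccExtend (zero_le_one' ℝ) h)

/-- Differentiability of a function on `[0, 1]` at an interior point. -/
def DiffUnitAt (h : C(I, ℝ)) (x : ℝ) : Prop :=
  DifferentiableAt ℝ (IccExtend (zero_le_one' ℝ) h) x

/-- Lebesgue measure on `[0, 1]`. -/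
abbrev unitMeasure : Measure ℝ := volume.restrict (Icc (0 : ℝ) 1)

/-- The `k`-th term of the series defining the binary Euclidean operator. -/
def euclidTerm (h : ℝ → ℝ) (k : ℕ) (x : ℝ) : ℝ :=
  (1 / (x + 2 ^ k)) ^ 2 * h (lowBranch k x) + (1 / (1 + 2 ^ k * x)) ^ 2 * h (highBranch k x)

/-- The function `B₂(h)`, by its series over `k ≥ 1` (indexed by `k + 1`, `k : ℕ`). -/
def euclidFun (h : ℝ → ℝ) (x : ℝ) : ℝ := ∑' k : ℕ, euclidTerm h (k + 1) x

theorem lintegral_branch_le {φ w : ℝ → ℝ} (c : ℝ≥0∞) (hc : c ≠ 0) (hc' : c ≠ ∞)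
    (hφ : ∀ x ∈ Icc (0 : ℝ) 1, φ x ∈ Icc (0 : ℝ) 1) (hinj : InjOn φ (Icc 0 1))
    {φ' : ℝ → ℝ} (hd : ∀ x ∈ Icc (0 : ℝ) 1, HasDerivWithinAt φ (φ' x) (Icc 0 1) x)
    (hw : ∀ x ∈ Icc (0 : ℝ) 1, c * ‖w x‖ₑ = ENNReal.ofReal |φ' x|) (f : ℝ → ℝ≥0∞) :
    ∫⁻ x, ‖w x‖ₑ * f (φ x) ∂unitMeasure ≤ c⁻¹ * ∫⁻ x, f x ∂unitMeasure := by
  rw [← ENNReal.mul_le_iff_le_inv hc hc', ← lintegral_const_mul' _ _ hc']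
  calc ∫⁻ x, c * (‖w x‖ₑ * f (φ x)) ∂unitMeasure
      = ∫⁻ x in Icc 0 1, ENNReal.ofReal |φ' x| * f (φ x) := by
        refine setLIntegral_congr_fun measurableSet_Icc fun x hx => ?_
        rw [← hw x hx, mul_assoc]
    _ = ∫⁻ x in φ '' Icc 0 1, f x :=
        (lintegral_image_eq_lintegral_abs_deriv_mul measurableSet_Icc hd hinj f).symm
    _ ≤ _ := lintegral_mono_set (by rintro _ ⟨x, hx, rfl⟩; exact hφ x hx)

theorem lintegral_low_le (k : ℕ) (f : ℝ → ℝ≥0∞) :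
    ∫⁻ x, ‖(1 / (x + 2 ^ k)) ^ 2‖ₑ * f (lowBranch k x) ∂unitMeasure
      ≤ (2 ^ k)⁻¹ * ∫⁻ x, f x ∂unitMeasure := by
  have h2 : (0 : ℝ) < 2 ^ k := by positivity
  refine lintegral_branch_le (φ' := fun x => 2 ^ k / (x + 2 ^ k) ^ 2) _ (by simp) (by simp)
    (fun x hx => lowBranch_mem k hx) ?_ ?_ ?_ f
  · intro x hx y hy hxy
    have hx0 := hx.1
    have hy0 := hy.1
    simp only [lowBranch] at hxy
    rw [div_eq_div_iff (by positivity) (by positivity)] at hxy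
    have : 2 ^ k * x = 2 ^ k * y := by linarith
    exact mul_left_cancel₀ h2.ne' this
  · intro x hx
    have hx0 := hx.1
    have hne : x + 2 ^ k ≠ 0 := by positivity
    have := ((hasDerivAt_id x).div ((hasDerivAt_id x).add_const (2 ^ k)) hne).hasDerivWithinAt
      (s := Icc 0 1)
    refine this.congr_deriv ?_
    simp
  · intro x hx
    have hx0 := hx.1
    rw [Real.enorm_eq_ofReal (by positivity), abs_of_nonneg (by positivity),
      show (2 : ℝ≥0∞) ^ k = ENNReal.ofReal (2 ^ k) by
        rw [ENNReal.ofReal_pow (by norm_num)]; norm_num,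
      ← ENNReal.ofReal_mul (by positivity)]
    congr 1
    rw [div_pow, one_pow, mul_one_div]

theorem lintegral_high_le (k : ℕ) (f : ℝ → ℝ≥0∞) :
    ∫⁻ x, ‖(1 / (1 + 2 ^ k * x)) ^ 2‖ₑ * f (highBranch k x) ∂unitMeasure
      ≤ (2 ^ k)⁻¹ * ∫⁻ x, f x ∂unitMeasure := by
  have h2 : (0 : ℝ) < 2 ^ k := by positivity
  refine lintegral_branch_le (φ' := fun x => - (2 ^ k) / (1 + 2 ^ k * x) ^ 2) _ (by simp) (by simp)
    (fun x hx => highBranch_mem k hx) ?_ ?_ ?_ f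
  · intro x hx y hy hxy
    have hx0 := hx.1
    have hy0 := hy.1
    simp only [highBranch] at hxy
    rw [div_eq_div_iff (by positivity) (by positivity)] at hxy
    have : 2 ^ k * x = 2 ^ k * y := by linarith
    exact mul_left_cancel₀ h2.ne' this
  · intro x hx
    have hx0 := hx.1
    have hne : 1 + 2 ^ k * x ≠ 0 := by positivity
    have := ((hasDerivAt_const x (1 : ℝ)).div
      (((hasDerivAt_id x).const_mul (2 ^ k)).const_add 1) hne).hasDerivWithinAt
      (s := Icc 0 1)
    refine this.congr_deriv ?_
    simp
  · intro x hx
    have hx0 := hx.1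
    rw [Real.enorm_eq_ofReal (by positivity), neg_div, abs_neg, abs_of_nonneg (by positivity),
      show (2 : ℝ≥0∞) ^ k = ENNReal.ofReal (2 ^ k) by
        rw [ENNReal.ofReal_pow (by norm_num)]; norm_num,
      ← ENNReal.ofReal_mul (by positivity)]
    congr 1
    rw [div_pow, one_pow, mul_one_div]

theorem measurable_euclidTerm {h : ℝ → ℝ} (hm : Measurable h) (k : ℕ) :
    Measurable (euclidTerm h k) := by
  unfold euclidTerm lowBranch highBranch
  fun_prop

theorem lintegral_euclidTerm_le {h : ℝ → ℝ} (hm : Measurable h) (k : ℕ) :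
    ∫⁻ x, ‖euclidTerm h (k + 1) x‖ₑ ∂unitMeasure
      ≤ (2 ^ k)⁻¹ * ∫⁻ x, ‖h x‖ₑ ∂unitMeasure := by
  have key : (2 ^ (k + 1) : ℝ≥0∞)⁻¹ + (2 ^ (k + 1))⁻¹ = (2 ^ k)⁻¹ := by
    rw [pow_succ, ENNReal.mul_inv (by simp) (by simp), ← mul_add, ENNReal.inv_two_add_inv_two,
      mul_one]
  rw [← key, add_mul]
  refine le_trans (lintegral_mono fun x => enorm_add_le _ _) ?_
  simp only [enorm_mul]
  rw [lintegral_add_left (by unfold lowBranch; fun_prop)]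
  exact add_le_add (lintegral_low_le _ fun x => ‖h x‖ₑ) (lintegral_high_le _ fun x => ‖h x‖ₑ)

theorem lintegral_tsum_euclidTerm_le {h : ℝ → ℝ} (hm : Measurable h) :
    ∫⁻ x, ∑' k : ℕ, ‖euclidTerm h (k + 1) x‖ₑ ∂unitMeasure
      ≤ 2 * ∫⁻ x, ‖h x‖ₑ ∂unitMeasure := by
  rw [lintegral_tsum fun k => (measurable_euclidTerm hm _).enorm.aemeasurable]
  refine le_trans (ENNReal.tsum_le_tsum fun k => lintegral_euclidTerm_le hm k) ?_
  rw [ENNReal.tsum_mul_right]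
  gcongr
  simp only [ENNReal.inv_pow, ENNReal.tsum_geometric, ENNReal.one_sub_inv_two, inv_inv, le_refl]

/-- The series defining `B₂(h)` converges absolutely almost everywhere on `[0, 1]`. -/
theorem ae_summable_euclidTerm {h : ℝ → ℝ} (hm : Measurable h) (hi : Integrable h unitMeasure) :
    ∀ᵐ x ∂unitMeasure, Summable fun k : ℕ => euclidTerm h (k + 1) x := by
  have hfin : ∫⁻ x, ∑' k : ℕ, ‖euclidTerm h (k + 1) x‖ₑ ∂unitMeasure ≠ ∞ :=
    ne_top_of_le_ne_top (ENNReal.mul_ne_top (by simp) hi.2.ne) (lintegral_tsum_euclidTerm_le hm)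
  have hmeas : Measurable fun x => ∑' k : ℕ, ‖euclidTerm h (k + 1) x‖ₑ :=
    Measurable.tsum fun k => (measurable_euclidTerm hm _).enorm
  filter_upwards [ae_lt_top hmeas hfin] with x hx
  exact Summable.of_enorm hx.ne

theorem enorm_euclidFun_le (h : ℝ → ℝ) (x : ℝ) :
    ‖euclidFun h x‖ₑ ≤ ∑' k : ℕ, ‖euclidTerm h (k + 1) x‖ₑ :=
  enorm_tsum_le_tsum_enorm

theorem lintegral_euclidFun_le {h : ℝ → ℝ} (hm : Measurable h) :
    ∫⁻ x, ‖euclidFun h x‖ₑ ∂unitMeasure ≤ 2 * ∫⁻ x, ‖h x‖ₑ ∂unitMeasure :=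
  (lintegral_mono fun x => enorm_euclidFun_le h x).trans (lintegral_tsum_euclidTerm_le hm)

theorem integrable_euclidFun {h : ℝ → ℝ} (hm : Measurable h) (hi : Integrable h unitMeasure) :
    Integrable (euclidFun h) unitMeasure := by
  refine ⟨?_, (lintegral_euclidFun_le hm).trans_lt (ENNReal.mul_lt_top (by simp) hi.2)⟩
  refine aestronglyMeasurable_of_tendsto_ae atTop
    (f := fun n x => ∑ k ∈ Finset.range n, euclidTerm h (k + 1) x) (fun n => ?_) ?_
  · exact (Finset.measurable_fun_sum _ fun k _ => measurable_euclidTerm hm _).aestronglyMeasurable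
  · filter_upwards [ae_summable_euclidTerm hm hi] with x hx
    exact hx.hasSum.tendsto_sum_nat

/-- Almost everywhere equal functions have almost everywhere equal images under `B₂`. -/
theorem euclidFun_congr_ae {h₁ h₂ : ℝ → ℝ} (hm₁ : Measurable h₁) (hm₂ : Measurable h₂)
    (he : h₁ =ᵐ[unitMeasure] h₂) : euclidFun h₁ =ᵐ[unitMeasure] euclidFun h₂ := by
  have h0 : ∫⁻ x, ∑' k : ℕ, ‖euclidTerm (h₁ - h₂) (k + 1) x‖ₑ ∂unitMeasure = 0 := by
    refine le_antisymm (le_trans (lintegral_tsum_euclidTerm_le (hm₁.sub hm₂)) ?_) zero_le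
    have : ∫⁻ x, ‖(h₁ - h₂) x‖ₑ ∂unitMeasure = 0 := by
      rw [lintegral_eq_zero_iff (hm₁.sub hm₂).enorm]
      filter_upwards [he] with x hx
      simp [hx]
    rw [this, mul_zero]
  rw [lintegral_eq_zero_iff
    (Measurable.tsum fun k => (measurable_euclidTerm (hm₁.sub hm₂) _).enorm)] at h0
  filter_upwards [h0] with x hx
  refine tsum_congr fun k => ?_
  have hk := ENNReal.tsum_eq_zero.1 hx k
  rw [enorm_eq_zero] at hk
  simp only [euclidTerm, Pi.sub_apply] at hk ⊢
  linarith

theorem integrable_euclidFun_coe (f : Lp ℝ 1 unitMeasure) :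
    Integrable (euclidFun f) unitMeasure :=
  integrable_euclidFun (Lp.stronglyMeasurable f).measurable (L1.integrable_coeFn f)

/-- The binary Euclidean operator `B₂`, a bounded linear operator of `L¹([0, 1])`. -/
def euclidOp : Lp ℝ 1 unitMeasure →L[ℝ] Lp ℝ 1 unitMeasure :=
  LinearMap.mkContinuous
    { toFun := fun f => (integrable_euclidFun_coe f).toL1 (euclidFun f)
      map_add' := fun f g => by
        have hf := (Lp.stronglyMeasurable f).measurable
        have hg := (Lp.stronglyMeasurable g).measurable
        rw [← Integrable.toL1_add, Integrable.toL1_eq_toL1_iff]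
        refine (euclidFun_congr_ae (Lp.stronglyMeasurable (f + g)).measurable (hf.add hg)
          (Lp.coeFn_add f g)).trans ?_
        filter_upwards [ae_summable_euclidTerm hf (L1.integrable_coeFn f),
          ae_summable_euclidTerm hg (L1.integrable_coeFn g)] with x h1 h2
        simp only [euclidFun, Pi.add_apply]
        rw [← h1.tsum_add h2]
        refine tsum_congr fun k => ?_
        simp only [euclidTerm, Pi.add_apply]
        ring
      map_smul' := fun c f => by
        have hf := (Lp.stronglyMeasurable f).measurable
        rw [RingHom.id_apply, ← Integrable.toL1_smul, Integrable.toL1_eq_toL1_iff]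
        refine (euclidFun_congr_ae (Lp.stronglyMeasurable (c • f)).measurable (hf.const_smul c)
          (Lp.coeFn_smul c f)).trans (ae_of_all _ fun x => ?_)
        simp only [euclidFun, smul_eq_mul]
        rw [← tsum_mul_left]
        refine tsum_congr fun k => ?_
        simp only [euclidTerm, Pi.smul_apply, smul_eq_mul]
        ring }
    2 fun f => by
      have hf := (Lp.stronglyMeasurable f).measurable
      have h1 := lintegral_euclidFun_le hf
      have h2 : ∫⁻ x, ‖f x‖ₑ ∂unitMeasure ≠ ∞ := (L1.integrable_coeFn f).2.ne
      have h3 := ENNReal.toReal_mono (ENNReal.mul_ne_top (by simp) h2) h1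
      rw [ENNReal.toReal_mul] at h3
      simp only [LinearMap.coe_mk, AddHom.coe_mk]
      rw [Integrable.norm_toL1_eq_lintegral_norm, Lp.norm_def, eLpNorm_one_eq_lintegral_enorm]
      simpa only [ofReal_norm, ENNReal.toReal_ofNat] using h3

end BinaryGcd

end

noncomputable section

namespace BinaryGcd

/-! This is a Doeblin contraction argument. Differentiating the series of `F`, the weight `2⁻ᵏ`
cancels the factor `2ᵏ` in the derivatives of the branches, so `F(G)' = B₂(G')` for regular `G`
(`IsRegular.hasDerivAt_brentOp`). Each `gₙ` thus falls from `1` to `0`, with a density `-gₙ'` of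
mass one that evolves under `B₂`.

The conditions in `IsRegular` are chosen to survive `B₂` even after a fixed multiple of the constant
density is removed. Monotonicity of `p` and of `x ^ 2 * p x` forces each other through the
decreasing branches, the bound `5 / √x` prevents mass from concentrating at `0`, and together they
give a uniform lower bound for `p` (`IsRegular.gap_le`). Hence `F(G) = gap • g₀ + (1 - gap) • R`
with `R` again regular (`IsRegular.exists_brentOp_eq`).

In a difference of two images the common part `gap • g₀` cancels, so `gₙ₊₁ - gₙ = (1 - gap) ^ n • (R
- R')` with `R`, `R'` regular. This gives geometric convergence in the supremum norm, and of the
derivatives at each point of `(0, 1)` with rate constant `5 / √x`. That function is integrable, so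
dominated convergence gives the `L¹` limit; the fixed point equations follow from continuity of `F`
and `B₂`. -/

/-- The extension of a function on `[0, 1]` to `ℝ` by constants. -/
abbrev unitExt (G : C(I, ℝ)) : ℝ → ℝ := IccExtend (zero_le_one' ℝ) G

theorem continuous_unitExt (G : C(I, ℝ)) : Continuous (unitExt G) :=
  G.continuous.Icc_extend'

theorem unitExt_coe (G : C(I, ℝ)) (x : I) : unitExt G x = G x := IccExtend_val _ _ x

/-- The size of the constant that can be split off from the image under `B₂` of a regular
density. -/
def gap : ℝ := 1 / 10 ^ 7

theorem gap_pos : 0 < gap := by norm_num [gap]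

/-- `G` decreases from `1` to `0` on `[0, 1]`, with density `p = -G'` such that `p` is
nonincreasing, `x ^ 2 * p x` is nondecreasing and `p x ≤ 5 / √x`. -/
structure IsRegular (G : C(I, ℝ)) (p : ℝ → ℝ) : Prop where
  zero : unitExt G 0 = 1
  one : unitExt G 1 = 0
  hasDerivAt : ∀ x ∈ Ioo (0 : ℝ) 1, HasDerivAt (unitExt G) (-p x) x
  nonneg : ∀ x ∈ Ioo (0 : ℝ) 1, 0 ≤ p x
  anti : AntitoneOn p (Ioo 0 1)
  mono : MonotoneOn (fun x => x ^ 2 * p x) (Ioo 0 1)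
  le_sqrt : ∀ x ∈ Ioo (0 : ℝ) 1, p x ≤ 5 / √x

/-! ### Elementary properties of the branches -/

theorem lowBranch_mem_Ioo (k : ℕ) {x : ℝ} (hx : x ∈ Ioo (0 : ℝ) 1) :
    lowBranch k x ∈ Ioo (0 : ℝ) 1 := by
  have h2 : (0 : ℝ) < 2 ^ k := by positivity
  have h0 := hx.1
  unfold lowBranch
  exact ⟨by positivity, by rw [div_lt_one (by positivity)]; linarith⟩

theorem highBranch_mem_Ioo (k : ℕ) {x : ℝ} (hx : x ∈ Ioo (0 : ℝ) 1) :
    highBranch k x ∈ Ioo (0 : ℝ) 1 := by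
  have h0 := hx.1
  have h2 : 0 < 2 ^ k * x := by positivity
  unfold highBranch
  exact ⟨by positivity, by rw [div_lt_one (by positivity)]; linarith⟩

theorem lowBranch_le (k : ℕ) {x z : ℝ} (hx : 0 < x) (hxz : x ≤ z) :
    lowBranch k x ≤ lowBranch k z := by
  have h2 : (0 : ℝ) < 2 ^ k := by positivity
  have hz := hx.trans_le hxz
  unfold lowBranch
  rw [div_le_div_iff₀ (by positivity) (by positivity)]
  nlinarith

theorem highBranch_le (k : ℕ) {x z : ℝ} (hx : 0 < x) (hxz : x ≤ z) :
    highBranch k z ≤ highBranch k x := by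
  unfold highBranch
  gcongr

theorem hasDerivAt_lowBranch (k : ℕ) {x : ℝ} (hx : 0 < x) :
    HasDerivAt (lowBranch k) (2 ^ k / (x + 2 ^ k) ^ 2) x := by
  have hne : x + 2 ^ k ≠ 0 := by positivity
  refine ((hasDerivAt_id x).div ((hasDerivAt_id x).add_const (2 ^ k)) hne).congr_deriv ?_
  simp

theorem hasDerivAt_highBranch (k : ℕ) {x : ℝ} (hx : 0 < x) :
    HasDerivAt (highBranch k) (-(2 ^ k) / (1 + 2 ^ k * x) ^ 2) x := by
  have hne : 1 + 2 ^ k * x ≠ 0 := by positivity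
  refine ((hasDerivAt_const x (1 : ℝ)).div
    (((hasDerivAt_id x).const_mul (2 ^ k)).const_add 1) hne).congr_deriv ?_
  simp

theorem unitExt_brentOp (G : C(I, ℝ)) {x : ℝ} (hx : x ∈ I) :
    unitExt (brentOp G) x = ∑' k : ℕ, (1 / 2 : ℝ) ^ (k + 1) *
      (unitExt G (lowBranch (k + 1) x) - unitExt G (highBranch (k + 1) x)) := by
  rw [unitExt, IccExtend_of_mem _ _ hx]
  refine tsum_congr fun k => ?_
  rw [← unitExt_coe, ← unitExt_coe]
  rfl

theorem summable_unitExt_branches (G : C(I, ℝ)) {x : ℝ} (hx : x ∈ I) :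
    Summable fun k : ℕ => (1 / 2 : ℝ) ^ (k + 1) *
      (unitExt G (lowBranch (k + 1) x) - unitExt G (highBranch (k + 1) x)) := by
  refine (brent_summable G ⟨x, hx⟩).congr fun k => ?_
  rw [← unitExt_coe, ← unitExt_coe]
  rfl

/-! ### A priori bounds for regular functions -/

namespace IsRegular

variable {G : C(I, ℝ)} {p : ℝ → ℝ}

/-- `Q + G` has derivative `q - p ≥ 0`. Only interior derivatives are needed, which admits a
multiple of the square root on an interval starting at `0`. -/
theorem sub_le (h : IsRegular G p) {a b : ℝ} (ha : 0 ≤ a) (hb : b ≤ 1) (hab : a ≤ b)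
    {Q q : ℝ → ℝ} (hQ : Continuous Q) (hq : ∀ y ∈ Ioo a b, HasDerivAt Q (q y) y)
    (hpq : ∀ y ∈ Ioo a b, p y ≤ q y) : unitExt G a - unitExt G b ≤ Q b - Q a := by
  have hd : ∀ y ∈ Ioo a b, HasDerivAt (fun y => Q y + unitExt G y) (q y + -p y) y := fun y hy =>
    (hq y hy).add (h.hasDerivAt y ⟨ha.trans_lt hy.1, hy.2.trans_le hb⟩)
  have hm : MonotoneOn (fun y => Q y + unitExt G y) (Icc a b) := by
    refine monotoneOn_of_deriv_nonneg (convex_Icc a b)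
      (hQ.add (continuous_unitExt G)).continuousOn ?_ ?_
    · rw [interior_Icc]
      exact fun y hy => (hd y hy).differentiableAt.differentiableWithinAt
    · rw [interior_Icc]
      intro y hy
      rw [(hd y hy).deriv]
      linarith [hpq y hy]
  have := hm (left_mem_Icc.2 hab) (right_mem_Icc.2 hab) hab
  simp only at this
  linarith

theorem antitoneOn (h : IsRegular G p) : AntitoneOn (unitExt G) (Icc 0 1) := by
  refine antitoneOn_of_deriv_nonpos (convex_Icc 0 1) (continuous_unitExt G).continuousOn ?_ ?_
  · rw [interior_Icc]
    exact fun y hy => (h.hasDerivAt y hy).differentiableAt.differentiableWithinAt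
  · rw [interior_Icc]
    intro y hy
    rw [(h.hasDerivAt y hy).deriv]
    linarith [h.nonneg y hy]

theorem mem_Icc (h : IsRegular G p) (x : I) : G x ∈ Icc (0 : ℝ) 1 := by
  rw [← unitExt_coe]
  constructor
  · rw [← h.one]
    exact h.antitoneOn x.2 (right_mem_Icc.2 zero_le_one) x.2.2
  · rw [← h.zero]
    exact h.antitoneOn (left_mem_Icc.2 zero_le_one) x.2 x.2.1

theorem norm_sub_le {G' : C(I, ℝ)} {p' : ℝ → ℝ} (h : IsRegular G p) (h' : IsRegular G' p') :
    ‖G - G'‖ ≤ 1 := by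
  rw [ContinuousMap.norm_le _ zero_le_one]
  intro x
  have h1 := h.mem_Icc x
  have h2 := h'.mem_Icc x
  rw [ContinuousMap.sub_apply, Real.norm_eq_abs, abs_le]
  exact ⟨by linarith [h1.1, h2.2], by linarith [h1.2, h2.1]⟩

theorem le_inv (h : IsRegular G p) {x : ℝ} (hx : x ∈ Ioo (0 : ℝ) 1) : x * p x ≤ 1 := by
  -- `G` drops by at least `x * p x` on `[0, x]`
  have hm : AntitoneOn (fun y => unitExt G y + y * p x) (Icc 0 x) := by
    have hd : ∀ y ∈ Ioo 0 x, HasDerivAt (fun y => unitExt G y + y * p x) (-p y + 1 * p x) y :=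
      fun y hy => (h.hasDerivAt y ⟨hy.1, hy.2.trans hx.2⟩).add ((hasDerivAt_id y).mul_const _)
    refine antitoneOn_of_deriv_nonpos (convex_Icc 0 x)
      ((continuous_unitExt G).add (by fun_prop)).continuousOn ?_ ?_
    · rw [interior_Icc]
      exact fun y hy => (hd y hy).differentiableAt.differentiableWithinAt
    · rw [interior_Icc]
      intro y hy
      rw [(hd y hy).deriv]
      linarith [h.anti ⟨hy.1, hy.2.trans hx.2⟩ hx hy.2.le]
  have h1 := hm (left_mem_Icc.2 hx.1.le) (right_mem_Icc.2 hx.1.le) hx.1.le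
  have h2 := (h.mem_Icc ⟨x, hx.1.le, hx.2.le⟩).1
  rw [← unitExt_coe] at h2
  simp only [h.zero] at h1
  linarith

/-- By the bound `5 / √y`, `G` loses at most `10 * √(1 / 400) = 1 / 2` on `[0, 1 / 400]`, hence at
least `1 / 2` on the rest, where the two monotonicity conditions bound `p` by a multiple of the
single value `p x`. -/
theorem gap_le (h : IsRegular G p) {x : ℝ} (hx : x ∈ Ioo (0 : ℝ) 1) : 27 * gap ≤ p x := by
  have hs : √(1 / 400 : ℝ) = 1 / 20 := by
    rw [show (1 / 400 : ℝ) = (1 / 20) ^ 2 by norm_num, Real.sqrt_sq (by norm_num)]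
  have h1 := h.sub_le (a := 0) (b := 1 / 400) le_rfl (by norm_num) (by norm_num)
    (Q := fun y => 10 * √y) (q := fun y => 10 * (1 / (2 * √y))) (by fun_prop)
    (fun y hy => (Real.hasDerivAt_sqrt hy.1.ne').const_mul 10) fun y hy => by
      refine (h.le_sqrt y ⟨hy.1, hy.2.trans (by norm_num)⟩).trans_eq ?_
      have := Real.sqrt_pos.2 hy.1
      field_simp
      norm_num
  -- Here `160000 = 400 ^ 2`: for `y ≤ x`, `y ^ 2 * p y ≤ x ^ 2 * p x ≤ p x` and `y ≥ 1 / 400`.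
  have h2 := h.sub_le (a := 1 / 400) (b := 1) (by norm_num) le_rfl (by norm_num)
    (Q := fun y => 160000 * p x * y) (q := fun y => 160000 * p x * 1) (by fun_prop)
    (fun y hy => (hasDerivAt_id y).const_mul _) fun y hy => by
      have hy' : y ∈ Ioo (0 : ℝ) 1 := ⟨lt_trans (by norm_num) hy.1, hy.2⟩
      have hp := h.nonneg x hx
      have hpy := h.nonneg y hy'
      rcases le_total x y with hxy | hxy
      · linarith [h.anti hx hy' hxy]
      · have h3 := h.mono hy' hx hxy
        simp only at h3
        have h4 : x ^ 2 * p x ≤ p x := mul_le_of_le_one_left hp (pow_le_one₀ hx.1.le hx.2.le)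
        have h5 : (1 / 400) ^ 2 * p y ≤ y ^ 2 * p y := by
          gcongr
          exact hy.1.le
        linarith
  simp only [hs, h.zero, h.one, Real.sqrt_zero] at h1 h2
  have := h.nonneg x hx
  norm_num [gap] at *
  linarith

end IsRegular

end BinaryGcd

/-! ### Action of `B₂` on regular densities -/

namespace BinaryGcd

namespace IsRegular

variable {G : C(I, ℝ)} {p : ℝ → ℝ}

theorem euclidTerm_nonneg (h : IsRegular G p) (k : ℕ) {x : ℝ} (hx : x ∈ Ioo (0 : ℝ) 1) :
    0 ≤ euclidTerm p k x :=
  add_nonneg (mul_nonneg (sq_nonneg _) (h.nonneg _ (lowBranch_mem_Ioo k hx)))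
    (mul_nonneg (sq_nonneg _) (h.nonneg _ (highBranch_mem_Ioo k hx)))

/-- The high branch contributes `y ^ 2 * p y` at a point `y` that decreases in `x`, so this half
rests on the field `mono`; the low branch uses `anti`. -/
theorem euclidTerm_antitoneOn (h : IsRegular G p) (k : ℕ) :
    AntitoneOn (euclidTerm p k) (Ioo 0 1) := by
  intro x hx z hz hxz
  have h2 : (0 : ℝ) < 2 ^ k := by positivity
  have hx0 := hx.1
  have hz0 := hz.1
  refine add_le_add (mul_le_mul ?_ ?_ ?_ ?_) ?_
  · gcongr
  · exact h.anti (lowBranch_mem_Ioo k hx) (lowBranch_mem_Ioo k hz) (lowBranch_le k hx.1 hxz)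
  · exact h.nonneg _ (lowBranch_mem_Ioo k hz)
  · positivity
  · exact h.mono (highBranch_mem_Ioo k hz) (highBranch_mem_Ioo k hx) (highBranch_le k hx.1 hxz)

theorem sq_mul_low_le (h : IsRegular G p) (k : ℕ) {x z : ℝ} (hx : x ∈ Ioo (0 : ℝ) 1)
    (hz : z ∈ Ioo (0 : ℝ) 1) (hxz : x ≤ z) :
    x ^ 2 * ((1 / (x + 2 ^ k)) ^ 2 * p (lowBranch k x)) ≤
      z ^ 2 * ((1 / (z + 2 ^ k)) ^ 2 * p (lowBranch k z)) := by
  have := h.mono (lowBranch_mem_Ioo k hx) (lowBranch_mem_Ioo k hz) (lowBranch_le k hx.1 hxz)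
  simp only [lowBranch, div_pow] at this ⊢
  calc _ = _ := by ring
    _ ≤ _ := this
    _ = _ := by ring

theorem mul_highBranch_le (k : ℕ) {x z : ℝ} (hx : 0 < x) (hxz : x ≤ z) :
    x * highBranch k x ≤ z * highBranch k z := by
  have h2 : (0 : ℝ) < 2 ^ k := by positivity
  have hz := hx.trans_le hxz
  unfold highBranch
  rw [mul_one_div, mul_one_div, div_le_div_iff₀ (by positivity) (by positivity)]
  nlinarith

/-- As `x` grows, `highBranch k x` decreases, so `p` there does not decrease, while `x * highBranch
k x` increases. The lower bound on `p` makes the growth quantitative, which leaves room to subtract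
a constant density. -/
theorem sq_mul_high_le (h : IsRegular G p) (k : ℕ) {x z : ℝ} (hx : x ∈ Ioo (0 : ℝ) 1)
    (hz : z ∈ Ioo (0 : ℝ) 1) (hxz : x ≤ z) :
    27 * gap * ((z * highBranch k z) ^ 2 - (x * highBranch k x) ^ 2) ≤
      z ^ 2 * (highBranch k z ^ 2 * p (highBranch k z)) -
      x ^ 2 * (highBranch k x ^ 2 * p (highBranch k x)) := by
  have h1 := h.anti (highBranch_mem_Ioo k hz) (highBranch_mem_Ioo k hx)
    (highBranch_le k hx.1 hxz)
  have h2 := h.gap_le (highBranch_mem_Ioo k hx)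
  have h3 : (x * highBranch k x) ^ 2 ≤ (z * highBranch k z) ^ 2 := by
    have := (highBranch_mem_Ioo k hx).1
    have := hx.1
    have := mul_highBranch_le k hx.1 hxz
    gcongr
  have h4 := mul_le_mul_of_nonneg_left h1 (sq_nonneg (z * highBranch k z))
  have h5 := mul_le_mul_of_nonneg_right h2 (sub_nonneg.2 h3)
  linarith

theorem sq_mul_euclidTerm_le (h : IsRegular G p) (k : ℕ) {x z : ℝ} (hx : x ∈ Ioo (0 : ℝ) 1)
    (hz : z ∈ Ioo (0 : ℝ) 1) (hxz : x ≤ z) :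
    27 * gap * ((z * highBranch k z) ^ 2 - (x * highBranch k x) ^ 2) ≤
      z ^ 2 * euclidTerm p k z - x ^ 2 * euclidTerm p k x := by
  have h1 := h.sq_mul_low_le k hx hz hxz
  have h2 := h.sq_mul_high_le k hx hz hxz
  simp only [euclidTerm, mul_add]
  simp only [highBranch] at h2 ⊢
  linarith

theorem sq_mul_euclidTerm_mono (h : IsRegular G p) (k : ℕ) {x z : ℝ} (hx : x ∈ Ioo (0 : ℝ) 1)
    (hz : z ∈ Ioo (0 : ℝ) 1) (hxz : x ≤ z) :
    0 ≤ z ^ 2 * euclidTerm p k z - x ^ 2 * euclidTerm p k x := by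
  refine le_trans ?_ (h.sq_mul_euclidTerm_le k hx hz hxz)
  have h1 := (highBranch_mem_Ioo k hx).1
  have h2 := hx.1
  have h3 := mul_highBranch_le k hx.1 hxz
  have := gap_pos
  have : (x * highBranch k x) ^ 2 ≤ (z * highBranch k z) ^ 2 := by gcongr
  exact mul_nonneg (by positivity) (sub_nonneg.2 this)

theorem sq_mul_highBranch_one_le {x z : ℝ} (hx : x ∈ Ioo (0 : ℝ) 1)
    (hz : z ∈ Ioo (0 : ℝ) 1) (hxz : x ≤ z) :
    z ^ 2 - x ^ 2 ≤ 27 * ((z * highBranch 1 z) ^ 2 - (x * highBranch 1 x) ^ 2) := by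
  obtain ⟨hx0, hx1⟩ := hx
  obtain ⟨hz0, hz1⟩ := hz
  unfold highBranch
  rw [pow_one, mul_one_div, mul_one_div]
  have e : z / (1 + 2 * z) - x / (1 + 2 * x) = (z - x) / ((1 + 2 * z) * (1 + 2 * x)) := by
    field_simp
    ring
  have h1 : (z - x) / 9 ≤ z / (1 + 2 * z) - x / (1 + 2 * x) := by
    rw [e]
    refine div_le_div_of_nonneg_left (sub_nonneg.2 hxz) (by positivity) ?_
    nlinarith
  have h2 : z / 3 ≤ z / (1 + 2 * z) :=
    div_le_div_of_nonneg_left hz0.le (by positivity) (by linarith)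
  have h3 : x / 3 ≤ x / (1 + 2 * x) :=
    div_le_div_of_nonneg_left hx0.le (by positivity) (by linarith)
  -- A difference of squares: the factors `1 / 9` and `1 / 3` give the constant `27`.
  have h4 := mul_le_mul h1 (add_le_add h2 h3) (by positivity) (by linarith)
  linarith

/-- The low branch yields `5 * (x + 2 ^ k) ^ (-3 / 2) / √x`, and `2 ^ (3 / 2) ≥ 8 / 3`. On the high
branch, `y * p y ≤ 1` leaves `1 / (1 + 2 ^ k * x)`, which is handled by the arithmetic-geometric
mean inequality and `√2 ≥ 4 / 3`. -/
theorem euclidTerm_le_sqrt (h : IsRegular G p) (k : ℕ) {x : ℝ} (hx : x ∈ Ioo (0 : ℝ) 1) :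
    euclidTerm p k x ≤ (5 * (3 / 8) ^ k + 1 / 2 * (3 / 4) ^ k) * (1 / √x) := by
  have hx0 := hx.1
  have h2 : (0 : ℝ) < 2 ^ k := by positivity
  have hs : 0 < √x := Real.sqrt_pos.2 hx0
  rw [add_mul]
  refine add_le_add ?_ ?_
  · have h1 := h.le_sqrt _ (lowBranch_mem_Ioo k hx)
    have hr : 0 < √(x + 2 ^ k) := Real.sqrt_pos.2 (by positivity)
    have hr2 : √(x + 2 ^ k) ^ 2 = x + 2 ^ k := Real.sq_sqrt (by positivity)
    have hr3 : (8 / 3 : ℝ) ^ k ≤ √(x + 2 ^ k) ^ 3 := by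
      refine (pow_le_pow_iff_left₀ (by positivity) (by positivity) two_ne_zero).1 ?_
      calc ((8 / 3 : ℝ) ^ k) ^ 2 = (64 / 9) ^ k := by rw [← pow_mul, mul_comm, pow_mul]; norm_num
        _ ≤ (2 ^ 3) ^ k := by gcongr; norm_num
        _ = (2 ^ k) ^ 3 := by rw [← pow_mul, mul_comm, pow_mul]
        _ ≤ (√(x + 2 ^ k) ^ 2) ^ 3 := by rw [hr2]; gcongr; linarith
        _ = _ := by ring
    calc (1 / (x + 2 ^ k)) ^ 2 * p (lowBranch k x)
        ≤ (1 / (x + 2 ^ k)) ^ 2 * (5 / √(lowBranch k x)) := by gcongr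
      _ = 5 * (√(x + 2 ^ k) ^ 3)⁻¹ * (1 / √x) := by
        unfold lowBranch
        rw [Real.sqrt_div hx0.le, ← hr2, Real.sqrt_sq hr.le]
        field_simp
      _ ≤ 5 * ((8 / 3 : ℝ) ^ k)⁻¹ * (1 / √x) := by gcongr
      _ = _ := by rw [← inv_pow]; norm_num
  · have hy := highBranch_mem_Ioo k hx
    have h1 := mul_le_mul_of_nonneg_left (h.le_inv hy) hy.1.le
    have h3 : (1 / (1 + 2 ^ k * x)) ^ 2 * p (highBranch k x) ≤ 1 / (1 + 2 ^ k * x) := by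
      simp only [highBranch] at h1 ⊢
      linarith
    refine h3.trans ?_
    have hq : (3 / 4 : ℝ) ^ k * (4 / 3) ^ k = 1 := by rw [← mul_pow]; norm_num
    have hq2 : ((4 / 3 : ℝ) ^ k) ^ 2 ≤ 2 ^ k := by
      rw [← pow_mul, mul_comm, pow_mul]
      gcongr
      norm_num
    have hx2 : √x ^ 2 = x := Real.sq_sqrt hx0.le
    rw [mul_one_div, div_le_div_iff₀ (by positivity) hs]
    have h4 : (3 / 4 : ℝ) ^ k * (2 * ((4 / 3) ^ k * √x)) ≤ (3 / 4) ^ k * (1 + 2 ^ k * x) := by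
      gcongr
      calc 2 * ((4 / 3) ^ k * √x) ≤ 1 + ((4 / 3) ^ k * √x) ^ 2 := by
            nlinarith [sq_nonneg ((4 / 3) ^ k * √x - 1)]
        _ = 1 + ((4 / 3) ^ k) ^ 2 * x := by rw [mul_pow, hx2]
        _ ≤ _ := by gcongr
    have h5 : (3 / 4 : ℝ) ^ k * (2 * ((4 / 3) ^ k * √x)) = 2 * √x := by
      rw [mul_left_comm, ← mul_assoc (_ ^ k), hq, one_mul]
    linarith

/-- The two geometric series give `3 + 3 / 2`. That `9 / 2` is strictly below `5` pays for the later
division by `1 - gap`. -/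
theorem hasSum_sqrt_bound (c : ℝ) :
    HasSum (fun k : ℕ => (5 * (3 / 8 : ℝ) ^ (k + 1) + 1 / 2 * (3 / 4) ^ (k + 1)) * c)
      (9 / 2 * c) := by
  have h1 := (hasSum_geometric_of_lt_one (r := 3 / 8) (by norm_num) (by norm_num)).mul_left
    (5 * (3 / 8 : ℝ))
  have h2 := (hasSum_geometric_of_lt_one (r := 3 / 4) (by norm_num) (by norm_num)).mul_left
    (1 / 2 * (3 / 4 : ℝ))
  have h3 := (h1.add h2).mul_right c
  rw [show (5 * (3 / 8) * (1 - 3 / 8)⁻¹ + 1 / 2 * (3 / 4) * (1 - 3 / 4)⁻¹ : ℝ) = 9 / 2 by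
    norm_num] at h3
  exact h3.congr_fun fun k => by ring

theorem summable_euclidTerm (h : IsRegular G p) {x : ℝ} (hx : x ∈ Ioo (0 : ℝ) 1) :
    Summable fun k : ℕ => euclidTerm p (k + 1) x :=
  Summable.of_nonneg_of_le (fun _ => h.euclidTerm_nonneg _ hx)
    (fun _ => h.euclidTerm_le_sqrt _ hx) (hasSum_sqrt_bound _).summable

theorem euclidFun_le_sqrt (h : IsRegular G p) {x : ℝ} (hx : x ∈ Ioo (0 : ℝ) 1) :
    euclidFun p x ≤ 9 / 2 * (1 / √x) :=
  hasSum_le (fun _ => h.euclidTerm_le_sqrt _ hx) (h.summable_euclidTerm hx).hasSum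
    (hasSum_sqrt_bound _)

theorem euclidFun_antitoneOn (h : IsRegular G p) : AntitoneOn (euclidFun p) (Ioo 0 1) :=
  fun _ hx _ hz hxz => (h.summable_euclidTerm hz).tsum_le_tsum
    (fun k => h.euclidTerm_antitoneOn (k + 1) hx hz hxz) (h.summable_euclidTerm hx)

theorem sq_mul_euclidFun_le (h : IsRegular G p) {x z : ℝ} (hx : x ∈ Ioo (0 : ℝ) 1)
    (hz : z ∈ Ioo (0 : ℝ) 1) (hxz : x ≤ z) :
    gap * (z ^ 2 - x ^ 2) ≤ z ^ 2 * euclidFun p z - x ^ 2 * euclidFun p x := by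
  have h1 := (h.summable_euclidTerm hx).hasSum.mul_left (x ^ 2)
  have h2 := (h.summable_euclidTerm hz).hasSum.mul_left (z ^ 2)
  -- All increments are nonnegative; only the one of index `0`, that is `k = 1` in the series, is
  -- kept.
  have h3 := le_hasSum (h2.sub h1) 0 fun k _ => h.sq_mul_euclidTerm_mono (k + 1) hx hz hxz
  refine le_trans ?_ h3
  refine le_trans ?_ (h.sq_mul_euclidTerm_le (0 + 1) hx hz hxz)
  have := mul_le_mul_of_nonneg_left (sq_mul_highBranch_one_le hx hz hxz) gap_pos.le
  rw [zero_add]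
  linarith

theorem gap_le_euclidFun (h : IsRegular G p) {x : ℝ} (hx : x ∈ Ioo (0 : ℝ) 1) :
    gap ≤ euclidFun p x := by
  have h1 := (h.summable_euclidTerm hx).le_tsum 0 fun k _ => h.euclidTerm_nonneg (k + 1) hx
  refine le_trans ?_ h1
  have h2 := h.gap_le (highBranch_mem_Ioo (0 + 1) hx)
  have h3 := mul_nonneg (sq_nonneg (1 / (x + 2 ^ (0 + 1))))
    (h.nonneg _ (lowBranch_mem_Ioo (0 + 1) hx))
  have h4 : (1 / 3 : ℝ) ≤ 1 / (1 + 2 ^ (0 + 1) * x) := by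
    have := hx.1
    rw [zero_add, pow_one]
    exact one_div_le_one_div_of_le (by positivity) (by linarith [hx.2])
  have h5 : (1 / 3 : ℝ) ^ 2 * (27 * gap) ≤
      (1 / (1 + 2 ^ (0 + 1) * x)) ^ 2 * p (highBranch (0 + 1) x) := by
    have := gap_pos
    gcongr
  unfold euclidTerm
  linarith [gap_pos]

theorem hasDerivAt_brentOp (h : IsRegular G p) {x : ℝ} (hx : x ∈ Ioo (0 : ℝ) 1) :
    HasDerivAt (unitExt (brentOp G)) (-euclidFun p x) x := by
  -- Termwise differentiation needs a summable bound uniform in the point, available only away from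
  -- `0`.
  set a := x / 2 with ha
  have ha0 : 0 < a := by have := hx.1; positivity
  have hax : x ∈ Ioo a 1 := ⟨by linarith, hx.2⟩
  have hsub : ∀ y ∈ Ioo a 1, y ∈ Ioo (0 : ℝ) 1 := fun y hy => ⟨ha0.trans hy.1, hy.2⟩
  have key := hasDerivAt_tsum_of_isPreconnected (t := Ioo a 1) (y₀ := x) (y := x)
    (g := fun (k : ℕ) y => (1 / 2 : ℝ) ^ (k + 1) *
      (unitExt G (lowBranch (k + 1) y) - unitExt G (highBranch (k + 1) y)))
    (g' := fun (k : ℕ) y => -euclidTerm p (k + 1) y)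
    (hasSum_sqrt_bound (1 / √a)).summable isOpen_Ioo isPreconnected_Ioo ?_ ?_ hax
    (summable_unitExt_branches G ⟨hx.1.le, hx.2.le⟩) hax
  · rw [tsum_neg] at key
    refine key.congr_of_eventuallyEq ?_
    filter_upwards [Ioo_mem_nhds hx.1 hx.2] with y hy
    exact unitExt_brentOp G ⟨hy.1.le, hy.2.le⟩
  · intro k y hy
    have hy' := hsub y hy
    have h1 := (h.hasDerivAt _ (lowBranch_mem_Ioo (k + 1) hy')).comp y
      (hasDerivAt_lowBranch (k + 1) hy'.1)
    have h2 := (h.hasDerivAt _ (highBranch_mem_Ioo (k + 1) hy')).comp y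
      (hasDerivAt_highBranch (k + 1) hy'.1)
    refine ((h1.sub h2).const_mul ((1 / 2 : ℝ) ^ (k + 1))).congr_deriv ?_
    have h3 : (1 / 2 : ℝ) ^ (k + 1) * 2 ^ (k + 1) = 1 := by rw [← mul_pow]; norm_num
    unfold euclidTerm
    generalize (1 / 2 : ℝ) ^ (k + 1) = d at *
    rw [one_div_pow, one_div_pow]
    linear_combination (-(p (lowBranch (k + 1) y) / (y + 2 ^ (k + 1)) ^ 2) -
      p (highBranch (k + 1) y) / (1 + 2 ^ (k + 1) * y) ^ 2) * h3
  · intro k y hy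
    rw [norm_neg, Real.norm_of_nonneg (h.euclidTerm_nonneg _ (hsub y hy))]
    refine (h.euclidTerm_le_sqrt _ (hsub y hy)).trans ?_
    have := Real.sqrt_pos.2 ha0
    gcongr
    exact hy.1.le

theorem brentOp_zero (h : IsRegular G p) : unitExt (brentOp G) 0 = 1 := by
  rw [unitExt_brentOp G (left_mem_Icc.2 zero_le_one)]
  simp only [lowBranch, highBranch, zero_div, mul_zero, add_zero, div_one, h.zero, h.one, sub_zero,
    mul_one, pow_succ]
  rw [tsum_mul_right, tsum_geometric_two]
  norm_num

theorem brentOp_one (G : C(I, ℝ)) : unitExt (brentOp G) 1 = 0 := by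
  rw [unitExt_brentOp G (right_mem_Icc.2 zero_le_one)]
  simp [lowBranch, highBranch]

end IsRegular

/-! ### Splitting off a constant density -/

theorem isRegular_brentSeq_zero : IsRegular (brentSeq 0) 1 where
  zero := by simp [unitExt, brentSeq]
  one := by simp [unitExt, brentSeq]
  hasDerivAt x hx := by
    refine ((hasDerivAt_id x).const_sub 1).congr_of_eventuallyEq ?_
    filter_upwards [Ioo_mem_nhds hx.1 hx.2] with y hy
    rw [unitExt, IccExtend_of_mem _ _ ⟨hy.1.le, hy.2.le⟩]
    rfl
  nonneg _ _ := zero_le_one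
  anti _ _ _ _ _ := le_rfl
  mono x hx z hz hxz := by
    have := hx.1
    simp only [Pi.one_apply, mul_one]
    gcongr
  le_sqrt x hx := by
    rw [Pi.one_apply, le_div_iff₀ (Real.sqrt_pos.2 hx.1), one_mul, Real.sqrt_le_left (by norm_num)]
    linarith [hx.2]

theorem gap_lt_one : gap < 1 := by norm_num [gap]

/-- Subtracting the multiple `gap` of the constant density from the image of a regular density
leaves a multiple of a regular density. -/
theorem IsRegular.exists_brentOp_eq {G : C(I, ℝ)} {p : ℝ → ℝ} (h : IsRegular G p) :
    ∃ R q, IsRegular R q ∧ brentOp G = gap • brentSeq 0 + (1 - gap) • R := by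
  have hg : 0 < 1 - gap := sub_pos.2 gap_lt_one
  set R : C(I, ℝ) := (1 - gap)⁻¹ • (brentOp G - gap • brentSeq 0) with hR
  have hext (x : ℝ) : unitExt R x =
      (1 - gap)⁻¹ * (unitExt (brentOp G) x - gap * unitExt (brentSeq 0) x) := rfl
  have h0 := isRegular_brentSeq_zero
  refine ⟨R, fun x => (1 - gap)⁻¹ * (euclidFun p x - gap), ⟨?_, ?_, ?_, ?_, ?_, ?_, ?_⟩, ?_⟩
  · rw [hext, h.brentOp_zero, h0.zero, mul_one, inv_mul_cancel₀ hg.ne']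
  · rw [hext, IsRegular.brentOp_one, h0.one]
    simp
  · intro x hx
    refine (((h.hasDerivAt_brentOp hx).sub
      ((h0.hasDerivAt x hx).const_mul gap)).const_mul (1 - gap)⁻¹).congr_deriv ?_
    simp only [Pi.one_apply]
    ring
  · intro x hx
    have := h.gap_le_euclidFun hx
    exact mul_nonneg (inv_nonneg.2 hg.le) (by linarith)
  · intro x hx z hz hxz
    have := h.euclidFun_antitoneOn hx hz hxz
    simp only
    gcongr
  · intro x hx z hz hxz
    have := mul_le_mul_of_nonneg_left (h.sq_mul_euclidFun_le hx hz hxz) (inv_nonneg.2 hg.le)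
    simp only
    linarith
  · intro x hx
    have h1 := h.euclidFun_le_sqrt hx
    have hs := Real.sqrt_pos.2 hx.1
    have h2 : 0 < 1 / √x := by positivity
    rw [inv_mul_le_iff₀ hg]
    have h3 : (1 - gap) * (5 / √x) = (1 - gap) * 5 * (1 / √x) := by ring
    -- The slack between `9 / 2` and `5` absorbs the renormalisation.
    have h4 : 9 / 2 * (1 / √x) ≤ (1 - gap) * 5 * (1 / √x) := by
      gcongr
      norm_num [gap]
    linarith [gap_pos]
  · rw [hR, smul_inv_smul₀ hg.ne', add_sub_cancel]

end BinaryGcd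

/-! ### Geometric convergence of the sequence and of its derivatives -/

namespace BinaryGcd

theorem IsRegular.map_brentOp {G : C(I, ℝ)} {p : ℝ → ℝ} (h : IsRegular G p) :
    IsRegular (brentOp G) (euclidFun p) where
  zero := h.brentOp_zero
  one := IsRegular.brentOp_one G
  hasDerivAt _ := h.hasDerivAt_brentOp
  nonneg _ hx := gap_pos.le.trans (h.gap_le_euclidFun hx)
  anti := h.euclidFun_antitoneOn
  mono x hx z hz hxz := by
    have h1 := h.sq_mul_euclidFun_le hx hz hxz
    have h2 : x ^ 2 ≤ z ^ 2 := pow_le_pow_left₀ hx.1.le hxz 2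
    have h3 := mul_nonneg gap_pos.le (sub_nonneg.2 h2)
    simp only
    linarith
  le_sqrt x hx := by
    have h1 := h.euclidFun_le_sqrt hx
    have h2 : 0 < 1 / √x := one_div_pos.2 (Real.sqrt_pos.2 hx.1)
    rw [← mul_one_div]
    linarith

theorem isRegular_brentSeq (n : ℕ) : IsRegular (brentSeq n) (euclidFun^[n] 1) := by
  induction n with
  | zero => exact isRegular_brentSeq_zero
  | succ n ih =>
    rw [Function.iterate_succ_apply']
    exact ih.map_brentOp

theorem exists_brentSeq_succ_sub_eq (n : ℕ) : ∃ R q R' q', IsRegular R q ∧ IsRegular R' q' ∧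
    brentSeq (n + 1) - brentSeq n = (1 - gap) ^ n • (R - R') := by
  induction n with
  | zero =>
    exact ⟨_, _, _, _, isRegular_brentSeq 1, isRegular_brentSeq 0, by rw [pow_zero, one_smul]⟩
  | succ n ih =>
    obtain ⟨R, q, R', q', h, h', e⟩ := ih
    obtain ⟨S, s, hS, eS⟩ := h.exists_brentOp_eq
    obtain ⟨S', s', hS', eS'⟩ := h'.exists_brentOp_eq
    refine ⟨S, s, S', s', hS, hS', ?_⟩
    change brentOp (brentSeq (n + 1)) - brentOp (brentSeq n) = _
    -- The common part `gap • brentSeq 0` cancels, leaving one more factor `1 - gap`.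
    rw [← map_sub, e, map_smul, map_sub, eS, eS', add_sub_add_left_eq_sub, ← smul_sub, smul_smul,
      pow_succ]

theorem one_sub_gap_pos : 0 < 1 - gap := sub_pos.2 gap_lt_one

theorem one_sub_gap_lt_one : 1 - gap < 1 := sub_lt_self _ gap_pos

theorem dist_brentSeq_succ_le (n : ℕ) :
    dist (brentSeq n) (brentSeq (n + 1)) ≤ 1 * (1 - gap) ^ n := by
  obtain ⟨R, q, R', q', h, h', e⟩ := exists_brentSeq_succ_sub_eq n
  have hn : 0 ≤ (1 - gap) ^ n := pow_nonneg one_sub_gap_pos.le n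
  rw [dist_comm, dist_eq_norm, e, norm_smul, Real.norm_of_nonneg hn, mul_comm]
  gcongr
  exact h.norm_sub_le h'

theorem IsRegular.derivUnit_eq {G : C(I, ℝ)} {p : ℝ → ℝ} (h : IsRegular G p) {x : ℝ}
    (hx : x ∈ Ioo (0 : ℝ) 1) : derivUnit G x = -p x :=
  (h.hasDerivAt x hx).deriv

theorem IsRegular.norm_derivUnit_le {G : C(I, ℝ)} {p : ℝ → ℝ} (h : IsRegular G p) {x : ℝ}
    (hx : x ∈ Ioo (0 : ℝ) 1) : ‖derivUnit G x‖ ≤ 5 / √x := by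
  rw [h.derivUnit_eq hx, norm_neg, Real.norm_of_nonneg (h.nonneg x hx)]
  exact h.le_sqrt x hx

/-- Both densities in the decomposition of `gₙ₊₁ - gₙ` lie between `0` and `5 / √x`, so their
difference does not exceed `5 / √x` in absolute value. -/
theorem dist_derivUnit_brentSeq_succ_le (n : ℕ) {x : ℝ} (hx : x ∈ Ioo (0 : ℝ) 1) :
    dist (derivUnit (brentSeq n) x) (derivUnit (brentSeq (n + 1)) x) ≤
      5 / √x * (1 - gap) ^ n := by
  obtain ⟨R, q, R', q', h, h', e⟩ := exists_brentSeq_succ_sub_eq n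
  have hd := ((isRegular_brentSeq (n + 1)).hasDerivAt x hx).sub
    ((isRegular_brentSeq n).hasDerivAt x hx)
  have hd' := ((h.hasDerivAt x hx).sub (h'.hasDerivAt x hx)).const_mul ((1 - gap) ^ n)
  have hf : unitExt (brentSeq (n + 1)) - unitExt (brentSeq n) =
      fun y => (1 - gap) ^ n * (unitExt R - unitExt R') y :=
    congrArg unitExt e
  rw [hf] at hd
  have hn : 0 ≤ (1 - gap) ^ n := pow_nonneg one_sub_gap_pos.le n
  rw [dist_comm, Real.dist_eq, (isRegular_brentSeq _).derivUnit_eq hx,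
    (isRegular_brentSeq _).derivUnit_eq hx, hd.unique hd', abs_mul, abs_of_nonneg hn, mul_comm]
  gcongr
  rw [abs_le]
  have h1 := h.nonneg x hx
  have h2 := h.le_sqrt x hx
  have h3 := h'.nonneg x hx
  have h4 := h'.le_sqrt x hx
  constructor <;> linarith

theorem exists_tendsto_derivUnit_brentSeq : ∃ L : ℝ → ℝ, ∀ x ∈ Ioo (0 : ℝ) 1,
    Tendsto (fun n => derivUnit (brentSeq n) x) atTop (𝓝 (L x)) := by
  have (x : ℝ) : ∃ l, x ∈ Ioo (0 : ℝ) 1 →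
      Tendsto (fun n => derivUnit (brentSeq n) x) atTop (𝓝 l) := by
    by_cases hx : x ∈ Ioo (0 : ℝ) 1
    · obtain ⟨l, hl⟩ := cauchySeq_tendsto_of_complete
        (cauchySeq_of_le_geometric _ _ one_sub_gap_lt_one
          fun n => dist_derivUnit_brentSeq_succ_le n hx)
      exact ⟨l, fun _ => hl⟩
    · exact ⟨0, fun h => absurd h hx⟩
  choose L hL using this
  exact ⟨L, hL⟩

theorem tendstoUniformlyOn_derivUnit_brentSeq {L : ℝ → ℝ}
    (hL : ∀ x ∈ Ioo (0 : ℝ) 1, Tendsto (fun n => derivUnit (brentSeq n) x) atTop (𝓝 (L x)))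
    {a : ℝ} (ha : 0 < a) :
    TendstoUniformlyOn (fun n => derivUnit (brentSeq n)) L atTop (Ioo a 1) := by
  rw [Metric.tendstoUniformlyOn_iff]
  intro ε hε
  have hlim : Tendsto (fun n : ℕ => 5 / √a * (1 - gap) ^ n / (1 - (1 - gap))) atTop (𝓝 0) := by
    have := ((tendsto_pow_atTop_nhds_zero_of_lt_one one_sub_gap_pos.le one_sub_gap_lt_one).const_mul
      (5 / √a)).div_const (1 - (1 - gap))
    rwa [mul_zero, zero_div] at this
  filter_upwards [hlim.eventually_lt_const hε] with n hn x hx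
  have hx' : x ∈ Ioo (0 : ℝ) 1 := ⟨ha.trans hx.1, hx.2⟩
  rw [dist_comm]
  refine lt_of_le_of_lt ?_ hn
  refine dist_le_of_le_geometric_of_tendsto _ _ one_sub_gap_lt_one (fun n => ?_) (hL x hx') n
  refine (dist_derivUnit_brentSeq_succ_le n hx').trans ?_
  have hs := Real.sqrt_pos.2 ha
  have hn : 0 ≤ (1 - gap) ^ n := pow_nonneg one_sub_gap_pos.le n
  gcongr
  exact hx.1.le

theorem hasDerivAt_of_tendsto_brentSeq {g : C(I, ℝ)} (hg : Tendsto brentSeq atTop (𝓝 g))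
    {L : ℝ → ℝ}
    (hL : ∀ x ∈ Ioo (0 : ℝ) 1, Tendsto (fun n => derivUnit (brentSeq n) x) atTop (𝓝 (L x)))
    {x : ℝ} (hx : x ∈ Ioo (0 : ℝ) 1) : HasDerivAt (unitExt g) (L x) x := by
  refine hasDerivAt_of_tendstoUniformlyOn (s := Ioo (x / 2) 1) (l := atTop)
    (f := fun n => unitExt (brentSeq n)) isOpen_Ioo
    (tendstoUniformlyOn_derivUnit_brentSeq hL (half_pos hx.1)) ?_ ?_ ⟨half_lt_self hx.1, hx.2⟩
  · refine Eventually.of_forall fun n y hy => ?_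
    exact ((isRegular_brentSeq n).hasDerivAt y
      ⟨(half_pos hx.1).trans hy.1, hy.2⟩).differentiableAt.hasDerivAt
  · intro y _
    exact ((continuous_eval_const (F := C(I, ℝ)) _).tendsto g).comp hg

/-! ### Passage to `L¹` -/

theorem ae_unitMeasure_of_forall_Ioo {P : ℝ → Prop} (h : ∀ x ∈ Ioo (0 : ℝ) 1, P x) :
    ∀ᵐ x ∂unitMeasure, P x := by
  rw [unitMeasure, ← Measure.restrict_congr_set Ioo_ae_eq_Icc, ae_restrict_iff' measurableSet_Ioo]
  exact ae_of_all _ h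

theorem integrable_div_sqrt : Integrable (fun x => 5 / √x) unitMeasure := by
  have h := ((intervalIntegrable_iff_integrableOn_Icc_of_le zero_le_one).1
    (intervalIntegral.intervalIntegrable_rpow' (a := 0) (b := 1) (r := -(1 / 2))
      (by norm_num))).const_mul 5
  refine h.congr (ae_unitMeasure_of_forall_Ioo fun x hx => ?_)
  simp only
  rw [Real.rpow_neg hx.1.le, ← Real.sqrt_eq_rpow, div_eq_mul_inv]

theorem measurable_derivUnit (G : C(I, ℝ)) : Measurable (derivUnit G) := measurable_deriv _

theorem integrable_derivUnit {G : C(I, ℝ)}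
    (h : ∀ x ∈ Ioo (0 : ℝ) 1, ‖derivUnit G x‖ ≤ 5 / √x) :
    Integrable (derivUnit G) unitMeasure :=
  integrable_div_sqrt.mono' (measurable_derivUnit G).aestronglyMeasurable
    (ae_unitMeasure_of_forall_Ioo h)

theorem tendsto_toL1_of_dominated {f : ℕ → ℝ → ℝ} {g b : ℝ → ℝ}
    (hf : ∀ n, Integrable (f n) unitMeasure) (hg : Integrable g unitMeasure)
    (hb : Integrable b unitMeasure) (hfb : ∀ n, ∀ᵐ x ∂unitMeasure, ‖f n x‖ ≤ b x)
    (hlim : ∀ᵐ x ∂unitMeasure, Tendsto (fun n => f n x) atTop (𝓝 (g x))) :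
    Tendsto (fun n => (hf n).toL1 (f n)) atTop (𝓝 (hg.toL1 g)) := by
  rw [tendsto_iff_edist_tendsto_0]
  simp only [Integrable.edist_toL1_toL1]
  simp only [edist_dist, dist_eq_norm]
  exact tendsto_lintegral_norm_of_dominated_convergence (fun n => (hf n).1) hb.2 hfb hlim

theorem euclidOp_toL1 {f g : ℝ → ℝ} (hm : Measurable f) (hf : Integrable f unitMeasure)
    (hg : Integrable g unitMeasure) (h : ∀ x ∈ Ioo (0 : ℝ) 1, euclidFun f x = g x) :
    euclidOp (hf.toL1 f) = hg.toL1 g := by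
  change (integrable_euclidFun_coe (hf.toL1 f)).toL1 (euclidFun (hf.toL1 f)) = _
  rw [Integrable.toL1_eq_toL1_iff]
  exact (euclidFun_congr_ae (Lp.stronglyMeasurable _).measurable hm hf.coeFn_toL1).trans
    (ae_unitMeasure_of_forall_Ioo h)

theorem IsRegular.euclidFun_derivUnit {G : C(I, ℝ)} {p : ℝ → ℝ} (h : IsRegular G p) {x : ℝ}
    (hx : x ∈ Ioo (0 : ℝ) 1) : euclidFun (derivUnit G) x = derivUnit (brentOp G) x := by
  rw [h.map_brentOp.derivUnit_eq hx, euclidFun, euclidFun, ← tsum_neg]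
  refine tsum_congr fun k => ?_
  rw [euclidTerm, euclidTerm, h.derivUnit_eq (lowBranch_mem_Ioo _ hx),
    h.derivUnit_eq (highBranch_mem_Ioo _ hx)]
  ring

end BinaryGcd

end

theorem mainTheorem1 :
    ∃ gInf : C(I, ℝ),
      -- `gInf` is the unique accumulation point of the sequence, for the supremum norm
      MapClusterPt gInf atTop BinaryGcd.brentSeq ∧
      (∀ g : C(I, ℝ), MapClusterPt g atTop BinaryGcd.brentSeq → g = gInf) ∧
      -- uniform convergence, and the limit is a fixed point of `F`
      Tendsto BinaryGcd.brentSeq atTop (𝓝 gInf) ∧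
      BinaryGcd.brentOp gInf = gInf ∧
      -- each `gₙ` is differentiable on `(0, 1)`, `gInf` is differentiable almost everywhere,
      -- and the derivatives converge almost everywhere on `[0, 1]`
      (∀ n : ℕ, ∀ x ∈ Ioo (0 : ℝ) 1, BinaryGcd.DiffUnitAt (BinaryGcd.brentSeq n) x) ∧
      (∀ᵐ x ∂BinaryGcd.unitMeasure, BinaryGcd.DiffUnitAt gInf x) ∧
      (∀ᵐ x ∂BinaryGcd.unitMeasure,
        Tendsto (fun n : ℕ => BinaryGcd.derivUnit (BinaryGcd.brentSeq n) x) atTop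
          (𝓝 (BinaryGcd.derivUnit gInf x))) ∧
      -- they are integrable, converge in `L¹([0, 1])`, and the limit is a fixed point of `B₂`
      ∃ (hn : ∀ n : ℕ,
          Integrable (BinaryGcd.derivUnit (BinaryGcd.brentSeq n)) BinaryGcd.unitMeasure)
        (hInf : Integrable (BinaryGcd.derivUnit gInf) BinaryGcd.unitMeasure),
        Tendsto (fun n : ℕ => (hn n).toL1 (BinaryGcd.derivUnit (BinaryGcd.brentSeq n))) atTop
          (𝓝 (hInf.toL1 (BinaryGcd.derivUnit gInf))) ∧
        BinaryGcd.euclidOp (hInf.toL1 (BinaryGcd.derivUnit gInf)) =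
          hInf.toL1 (BinaryGcd.derivUnit gInf) := by
  obtain ⟨g, hg⟩ := cauchySeq_tendsto_of_complete
    (cauchySeq_of_le_geometric _ _ BinaryGcd.one_sub_gap_lt_one BinaryGcd.dist_brentSeq_succ_le)
  obtain ⟨L, hL⟩ := BinaryGcd.exists_tendsto_derivUnit_brentSeq
  have hd : ∀ x ∈ Ioo (0 : ℝ) 1, HasDerivAt (BinaryGcd.unitExt g) (L x) x := fun x hx =>
    BinaryGcd.hasDerivAt_of_tendsto_brentSeq hg hL hx
  have hlim : ∀ x ∈ Ioo (0 : ℝ) 1, Tendsto (fun n : ℕ =>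
      BinaryGcd.derivUnit (BinaryGcd.brentSeq n) x) atTop (𝓝 (BinaryGcd.derivUnit g x)) := by
    intro x hx
    rw [show BinaryGcd.derivUnit g x = L x from (hd x hx).deriv]
    exact hL x hx
  have hbound (n : ℕ) (x : ℝ) (hx : x ∈ Ioo (0 : ℝ) 1) :=
    (BinaryGcd.isRegular_brentSeq n).norm_derivUnit_le hx
  have hint (n : ℕ) := BinaryGcd.integrable_derivUnit (hbound n)
  have hint' : Integrable (BinaryGcd.derivUnit g) BinaryGcd.unitMeasure :=
    BinaryGcd.integrable_derivUnit fun x hx =>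
      le_of_tendsto (hlim x hx).norm (Eventually.of_forall fun n => hbound n x hx)
  have hL1 := BinaryGcd.tendsto_toL1_of_dominated hint hint' BinaryGcd.integrable_div_sqrt
    (fun n => BinaryGcd.ae_unitMeasure_of_forall_Ioo (hbound n))
    (BinaryGcd.ae_unitMeasure_of_forall_Ioo hlim)
  refine ⟨g, hg.mapClusterPt, fun g' hg' => ?_, hg, ?_, fun n x hx => ?_, ?_, ?_, hint, hint',
    hL1, ?_⟩
  · exact eq_of_nhds_neBot (hg'.neBot.mono (inf_le_inf_left _ hg))
  -- `F(gₙ) = gₙ₊₁` holds by definition, so both limits are of the same sequence.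
  · exact tendsto_nhds_unique ((BinaryGcd.brentOp.continuous.tendsto g).comp hg)
      (hg.comp (tendsto_add_atTop_nat 1))
  · exact ((BinaryGcd.isRegular_brentSeq n).hasDerivAt x hx).differentiableAt
  · exact BinaryGcd.ae_unitMeasure_of_forall_Ioo fun x hx => (hd x hx).differentiableAt
  · exact BinaryGcd.ae_unitMeasure_of_forall_Ioo hlim
  -- The same shift argument in `L¹`, with `B₂(gₙ') = gₙ₊₁'`.
  · refine tendsto_nhds_unique ((BinaryGcd.euclidOp.continuous.tendsto _).comp hL1) ?_
    refine (hL1.comp (tendsto_add_atTop_nat 1)).congr fun n => ?_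
    exact (BinaryGcd.euclidOp_toL1 (BinaryGcd.measurable_derivUnit _) (hint n) (hint (n + 1))
      fun x hx => (BinaryGcd.isRegular_brentSeq n).euclidFun_derivUnit hx).symm
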